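/- **Automata, networks.** Fix a finite nonempty set $X$ of clocks, a finite set $\mathit{Int}$ of integer variables, each variable $n$ with a domain $D_n\subseteq\mathbb Z$ and an initial value $v^0(n)\in D_n$, a set $AP$ of propositions and a set $Act$ of channels; an action is $\tau$ or a channel with one of the qualifiers $!,?,\#,@,\&,*$. A clock constraint is a finite conjunction of literals $x\sim d$, $\neg(x\sim d)$ with $x\in X$, $d\in\mathbb N$, $\sim\,\in\{<,=,>\}$. For $v:X\to\mathbb R_{\ge0}$, weak satisfaction $v\models_w\gamma$ is satisfaction with $x<d$ read as $x\le d$, $x>d$ as $x\ge d$, $x=d$ as false, $\neg(x=d)$ as true, and $\neg(x<d)$, $\neg(x>d)$ unchanged. A network $\mathcal N=\{\mathcal A_1,\dots,\mathcal A_K\}$ consists of automata with locations $Q_k=\{0,\dots,m_k\}$ (initial location $0$), invariants $Inv(q)$ that are clock constraints with convex solution sets in $\mathbb R_{\ge 0}^X$, labels $L(q)\subseteq AP$ and a finite, enumerated family $T_k$ of transitions $q\xrightarrow{\gamma,\xi,\alpha,\zeta,\mu}q'$: $\gamma$ a clock constraint, $\xi$ a Boolean combination of atoms $n\sim c$, $n\sim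 n'$ ($\sim\,\in\{<,=\}$, $c\in\mathbb Z$), $\alpha$ an action, $\zeta\subseteq X$ the reset clocks, $\mu$ a finite set of assignments $n:=e$, with $e$ an arithmetic expression over $\mathit{Int}$ and $\mathbb Z$. For a transition $t$, $t^-=q$, $t^+=q'$, and $U(t)$ is the set of left-hand sides in $\mu$. **Traces.** A configuration $(\mathtt l,u,v)$ gives a location $\mathtt l[k]$ for each $k$, variable values $u(n)\in D_n$ and clock values $v(x)\ge0$. For $\delta>0$, $(\mathtt l,u,v)\xrightarrow{\delta}(\mathtt l,u,v+\delta)$ if $v+\delta\models_w Inv(\mathtt l[k])$ for all $k$. For $\Lambda$ with $\Lambda[k]=\_$ or $\Lambda[k]=(\alpha,b)$, $b\in\{\mathtt{ei},\mathtt{ie}\}$, we have $(\mathtt l,u,v)\xrightarrow{\Lambda}(\mathtt l',u',v')$ if transitions can be chosen, one $t_k\in T_k$ for each $k$ with $\Lambda[k]\ne\_$, such that: * if $\Lambda[k]=(\alpha,b)$, then $t_k$ goes from $\mathtt l[k]$ to $\mathtt l'[k]$ with action $\alpha$, $v\models\gamma$, $u\models\xi$, $v'(x)=0$ for $x\in\zeta$,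 $u'(n)=e(u)$ for each $n:=e$ in $\mu$; and $v\models_w Inv(\mathtt l[k])$, $v'\models Inv(\mathtt l'[k])$ if $b=\mathtt{ei}$, while $v\models Inv(\mathtt l[k])$, $v'\models_w Inv(\mathtt l'[k])$ if $b=\mathtt{ie}$; * if $\Lambda[k]=\_$, then $\mathtt l'[k]=\mathtt l[k]$, $v\models Inv(\mathtt l[k])$ and $v'\models Inv(\mathtt l'[k])$; * clocks reset by no $t_k$ and variables assigned by no $t_k$ keep their values. A trace is an infinite sequence of configurations linked by such time and discrete transitions, whose first transition is a time transition, in which no two discrete transitions are consecutive, and whose first configuration has all locations $0$, all clocks $0$, all variables at $v^0$, and satisfies $Inv(\mathtt l_0[k])$ for all $k$. Inserting, between any two consecutive time transitions, a discrete step with all symbols $\_$ that changes nothing, one writes a trace as $$(\mathtt l_0,u_0,v_0)\xrightarrow{\delta_0}(\mathtt l'_0,u'_0,v'_0)\xrightarrow{\Lambda_0}(\mathtt l_1,u_1,v_1)\xrightarrow{\delta_1}\cdots$$ **CLTLoc$_v$.** Formulae are built with $\wedge,\neg$, next $\mathsf X$ and until from propositions, $x\sim c$ ($c\in\mathbb N$),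 $e_1\sim e_2$ and $\mathsf X(n)\sim e$, $\sim\,\in\{<,=\}$. An interpretation $(\pi,\sigma,\iota)$ gives at every position $i\in\mathbb N$ a set $\pi(i)$ of propositions, clock values $\sigma(i,x)\ge0$ and integer values $\iota(i,n)$ in the domain of $n$, such that for some $\delta_i>0$ with $\sum_i\delta_i=\infty$ every clock satisfies $\sigma(i+1,x)\in\{\sigma(i,x)+\delta_i,\,0\}$. The semantics is the usual one of LTL, where $\mathsf X(n)$ is the value of $n$ at the next position. A model of a formula is an interpretation satisfying it at position $0$. **The formula $\varphi_{\mathcal N}$.** It uses propositions $AP$ and $\mathrm{edge}^{](}[k]$; clocks $x_0,x_1$ for each $x\in X$; and integer variables $\mathtt l[k]$ with domain $Q_k$, $\mathtt t[k]$ with domain $\{0,\dots,|T_k|-1\}\cup\{\natural\}$, $\mathtt x_v$ with domain $\{0,1\}$ (index of the active copy of $x$), and each $n\in\mathit{Int}$ with domain $D_n$. Let $\phi_{x\sim d}=((x_0\sim d)\wedge\mathtt x_v=0)\vee((x_1\sim d)\wedge\mathtt x_v=1)$ and let $\phi_\gamma$ replace every $x\sim d$ in $\gamma$ by $\phi_{x\sim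 d}$. Inside formulae $Inv(q)$ stands for $\phi_{Inv(q)}$, and $Inv_w(q)$ for the same applied to the weak reading of $Inv(q)$. Let $\mathrm{rs}(x)=(x_0=0\vee x_1=0)$, and for a literal $\beta$ on $x$ let $\beta_{[x\leftarrow0]}$ be its truth value at $x=0$. The rewriting $r_1$ replaces each literal $\beta$ by $\mathrm{rs}(x)\to\beta_{[x\leftarrow0]}$; $r_2$ replaces it by $((x_0>0\wedge x_1>0)\to\phi_\beta)\wedge(\mathrm{rs}(x)\to\beta_{[x\leftarrow0]})$. Then $\varphi_{\mathcal N}=\phi_{clock}\wedge\varphi_1\wedge\varphi_2\wedge\varphi_3\wedge\mathsf G(\varphi_4\wedge\dots\wedge\varphi_8)$, where ($\mathsf R$ is release) * $\phi_{clock}=\bigwedge_x(x_0=0\wedge x_1>0\wedge\mathtt x_v=0)\wedge\mathsf G\bigwedge_{j=0,1}\bigwedge_x\big(x_j=0\to\mathsf X(x_{1-j}=0\ \mathsf R\ (\mathtt x_v=j\wedge x_j>0))\big)$; * $\varphi_1=\bigwedge_k\mathtt l[k]=0$, $\ \varphi_2=\bigwedge_n n=v^0(n)$, $\ \varphi_3=\bigwedge_{k,q}(\mathtt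 l[k]=q\to Inv(q))$; * $\varphi_4=\bigwedge_{k,q}\big((\mathtt l[k]=q\wedge\mathtt t[k]=\natural)\to\mathsf X(Inv(q)\wedge r_1(Inv(q)))\big)$; * $\varphi_5=\bigwedge_{k,\,t\in T_k}\big(\mathtt t[k]=t\to\mathtt l[k]=t^-\wedge\phi_\xi\wedge\bigwedge_{(n:=e)\in\mu}\mathsf X(n)=e\wedge\mathsf X(\mathtt l[k]=t^+\wedge\phi_\gamma\wedge\bigwedge_{x\in\zeta}\mathrm{rs}(x)\wedge\phi_{edge})\big)$, where $\phi_{edge}=(Inv(t^-)\wedge r_2(Inv_w(t^+))\wedge\mathrm{edge}^{](}[k])\vee(Inv_w(t^-)\wedge r_2(Inv(t^+))\wedge\neg\mathrm{edge}^{](}[k])$; * $\varphi_6=\bigwedge_{k,\,q\ne q'}\big((\mathtt l[k]=q\wedge\mathsf X(\mathtt l[k]=q'))\to\bigvee_{t\in T_k,\,t^-=q,\,t^+=q'}\mathtt t[k]=t\big)$; * $\varphi_7=\bigwedge_x\big(\mathsf X\,\mathrm{rs}(x)\to\bigvee_{k,\,t\in T_k:\,x\in\zeta}\mathtt t[k]=t\big)$;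 * $\varphi_8=\bigwedge_n\big(\neg(\mathsf X(n)=n)\to\bigvee_{k,\,t\in T_k:\,n\in U(t)}\mathtt t[k]=t\big)$. **The map $\rho$.** For a trace $\eta$ in the form above, $\rho(\eta)$ is the set of all interpretations $(\pi,\sigma,\iota)$ such that for all $h\in\mathbb N$: * $\iota(h,\mathtt l[k])=\mathtt l_h[k]$, $\iota(h,n)=u_h(n)$; a proposition $p\in AP$ is in $\pi(h)$ iff $p\in L(\mathtt l_h[k])$ for some $k$; * $\sigma(0,x_0)=0<\sigma(0,x_1)$, $\iota(0,\mathtt x_v)=\iota(1,\mathtt x_v)=0$; with $x_a$ the active copy at position $h+1$ and $x_i$ the other copy, $\sigma(h+1,x_a)=\sigma(h,x_a)+\delta_h$; if $x$ is reset at $h+1$ (that is, $v_{h+1}(x)=0$), then $\sigma(h+1,x_i)=0$ and $\iota(h+2,\mathtt x_v)=1-\iota(h+1,\mathtt x_v)$; otherwise $\sigma(h+1,x_i)=\sigma(h,x_i)+\delta_h$ and $\iota(h+2,\mathtt x_v)=\iota(h+1,\mathtt x_v)$; * $\iota(h,\mathtt t[k])=\natural$ if $\Lambda_h[k]=\_$;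 and the transitions $\iota(h,\mathtt t[k])$ for the other $k$ form a choice $(t_k)$ that meets the requirements on locations, actions, guards, resets, assignments and unchanged values for the step $\Lambda_h$ from $(\mathtt l'_h,u'_h,v'_h)$ to $(\mathtt l_{h+1},u_{h+1},v_{h+1})$; * if $\Lambda_h[k]=(\alpha,b)$, then $\mathrm{edge}^{](}[k]\in\pi(h+1)$ iff $b=\mathtt{ie}$. **The map $\rho^{-1}$.** $\rho^{-1}(\pi,\sigma,\iota)$ is the alternating sequence with $\mathtt l_h[k]=\mathtt l'_h[k]=\iota(h,\mathtt l[k])$, $u_h(n)=u'_h(n)=\iota(h,n)$; $v_h(x)=0$ if $\sigma(h,x_0)=0$ or $\sigma(h,x_1)=0$, and otherwise $v_h(x)$ is the value at $h$ of the copy of $x$ active at $h$; $v'_h(x)$ is the value at $h+1$ of the copy active at $h+1$; $\delta_h$ is the delay of $\sigma$ between $h$ and $h+1$; $\Lambda_h[k]=\_$ if $\iota(h,\mathtt t[k])=\natural$, and otherwise $\Lambda_h[k]=(\alpha,b)$ with $\alpha$ the action of the transition $\iota(h,\mathtt t[k])$, and $b=\mathtt{ie}$ if $\mathrm{edge}^{](}[k]\in\pi(h+1)$,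 $b=\mathtt{ei}$ otherwise. **Theorem.** Let $\mathcal N$ be a network of timed automata. For every trace $\eta$ of $\mathcal N$, every interpretation $(\pi,\sigma,\iota)\in\rho(\eta)$ is a model of $\varphi_{\mathcal N}$. Conversely, for every model $(\pi,\sigma,\iota)$ of $\varphi_{\mathcal N}$, $\rho^{-1}(\pi,\sigma,\iota)$ is a trace of $\mathcal N$. -/

import Mathlib

open scoped NNReal

/-! # Constraint LTL over clocks and integer variables -/

namespace CLTLoc

/-- The relations `<` and `=` of the atomic formulae. -/
inductive Rel where
  | lt
  | eq

/-- The meaning of a relation symbol. -/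
def Rel.holds {α : Type*} [LT α] : Rel → α → α → Prop
  | .lt, a, b => a < b
  | .eq, a, b => a = b

/-- Arithmetic expressions over integer variables and integer constants. -/
inductive Expr (V : Type*) where
  | const (c : ℤ)
  | var (n : V)
  | neg (e : Expr V)
  | add (e₁ e₂ : Expr V)
  | sub (e₁ e₂ : Expr V)
  | mul (e₁ e₂ : Expr V)

/-- Value of an expression under a valuation of the variables. -/
def Expr.eval {V : Type*} (val : V → ℤ) : Expr V → ℤ
  | .const c => c
  | .var n => val n
  | .neg e => -e.eval val
  | .add e₁ e₂ => e₁.eval val + e₂.eval val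
  | .sub e₁ e₂ => e₁.eval val - e₂.eval val
  | .mul e₁ e₂ => e₁.eval val * e₂.eval val

/-- Renaming of the variables of an expression. -/
def Expr.map {V W : Type*} (f : V → W) : Expr V → Expr W
  | .const c => .const c
  | .var n => .var (f n)
  | .neg e => .neg (e.map f)
  | .add e₁ e₂ => .add (e₁.map f) (e₂.map f)
  | .sub e₁ e₂ => .sub (e₁.map f) (e₂.map f)
  | .mul e₁ e₂ => .mul (e₁.map f) (e₂.map f)

/-- Formulae over propositions `P`, clocks `C` and integer variables `V`. -/
inductive Formula (P C V : Type*) where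
  | prop (p : P)
  | clock (x : C) (r : Rel) (c : ℕ)
  | cmp (e₁ : Expr V) (r : Rel) (e₂ : Expr V)
  | nextCmp (n : V) (r : Rel) (e : Expr V)
  | and (φ ψ : Formula P C V)
  | not (φ : Formula P C V)
  | next (φ : Formula P C V)
  | until (φ ψ : Formula P C V)

/-- A clock assignment: all clocks progress by the same positive delay between adjacent positions,
unless they are reset to `0`, and the delays sum up to infinity. -/
def IsClockAssignment {C : Type*} (σ : ℕ → C → ℝ≥0) (δ : ℕ → ℝ≥0) : Prop :=
  (∀ i, 0 < δ i) ∧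
  (∀ i x, σ (i + 1) x = σ i x + δ i ∨ σ (i + 1) x = 0) ∧
  Filter.Tendsto (fun n => ∑ i ∈ Finset.range n, δ i) Filter.atTop Filter.atTop

/-- Interpretations `(π, σ, ι)`, where every integer variable `n` ranges over a given
domain `D n ⊆ ℤ`. -/
structure Interp (P C V : Type*) (D : V → Set ℤ) where
  /-- the propositions that hold at every position -/
  π : ℕ → Set P
  /-- the values of the clocks at every position -/
  σ : ℕ → C → ℝ≥0
  /-- the values of the integer variables at every position -/
  ι : ℕ → V → ℤ
  clockAssignment : ∃ δ, IsClockAssignment σ δ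
  mem_dom : ∀ i n, ι i n ∈ D n

/-- The delays of an interpretation. The delay between `i` and `i + 1` is determined by `σ` as soon
as some clock is not `0` at position `i + 1`. -/
noncomputable def Interp.delay {P C V : Type*} {D : V → Set ℤ} (M : Interp P C V D) : ℕ → ℝ≥0 :=
  M.clockAssignment.choose

/-- Satisfaction of a formula at a position. -/
def Interp.Sat {P C V : Type*} {D : V → Set ℤ} (M : Interp P C V D) :
    ℕ → Formula P C V → Prop
  | i, .prop p => p ∈ M.π i
  | i, .clock x r c => r.holds (M.σ i x) (c : ℝ≥0)
  | i, .cmp e₁ r e₂ => r.holds (e₁.eval (M.ι i)) (e₂.eval (M.ι i))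
  | i, .nextCmp n r e => r.holds (M.ι (i + 1) n) (e.eval (M.ι i))
  | i, .and φ ψ => M.Sat i φ ∧ M.Sat i ψ
  | i, .not φ => ¬ M.Sat i φ
  | i, .next φ => M.Sat (i + 1) φ
  | i, .until φ ψ => ∃ j, i ≤ j ∧ M.Sat j ψ ∧ ∀ m, i ≤ m → m < j → M.Sat m φ

/-- `(π, σ, ι)` is a model of `φ` if `φ` holds at position `0`. -/
def Interp.IsModel {P C V : Type*} {D : V → Set ℤ} (M : Interp P C V D)
    (φ : Formula P C V) : Prop :=
  M.Sat 0 φ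

namespace Formula

variable {P C V : Type*}

/-- The formula true. -/
def top : Formula P C V := .cmp (.const 0) .eq (.const 0)

/-- The formula false. -/
def bot : Formula P C V := .not top

/-- Disjunction. -/
def or (φ ψ : Formula P C V) : Formula P C V := .not (.and (.not φ) (.not ψ))

/-- Implication. -/
def imp (φ ψ : Formula P C V) : Formula P C V := or (.not φ) ψ

/-- The LTL modality "eventually". -/
def eventually (φ : Formula P C V) : Formula P C V := .until top φ

/-- The LTL modality "globally". -/
def globally (φ : Formula P C V) : Formula P C V := .not (eventually (.not φ))

/-- The LTL modality "release". -/
def release (φ ψ : Formula P C V) : Formula P C V := .not (.until (.not φ) (.not ψ))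

/-- Conjunction of a list of formulae. -/
def bigAnd : List (Formula P C V) → Formula P C V
  | [] => top
  | φ :: l => .and φ (bigAnd l)

/-- Disjunction of a list of formulae. -/
def bigOr : List (Formula P C V) → Formula P C V
  | [] => bot
  | φ :: l => or φ (bigOr l)

/-- Conjunction over a finite index set. -/
noncomputable def all {I : Type*} (s : Finset I) (f : I → Formula P C V) : Formula P C V :=
  bigAnd (s.toList.map f)

/-- Disjunction over a finite index set. -/
noncomputable def any {I : Type*} (s : Finset I) (f : I → Formula P C V) : Formula P C V :=
  bigOr (s.toList.map f)

/-- The constant `true` or `false` with the truth value of a proposition. -/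
noncomputable def ofProp (p : Prop) : Formula P C V :=
  open Classical in if p then top else bot

/-- Integer variable `n` has value `c`. -/
def varEq (n : V) (c : ℤ) : Formula P C V := .cmp (.var n) .eq (.const c)

end Formula

end CLTLoc

/-! # Networks of timed automata with variables -/

namespace TANet

open CLTLoc (Rel Expr Formula Interp)

/-- The relations `<`, `=`, `>` of the atomic clock constraints. -/
inductive ClockRel where
  | lt
  | eq
  | gt

/-- The meaning of `a ∼ d` for a clock value `a`. -/
def ClockRel.holds : ClockRel → ℝ≥0 → ℕ → Prop
  | .lt, a, d => a < d
  | .eq, a, d => a = d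
  | .gt, a, d => (d : ℝ≥0) < a

/-- Literals: `x ∼ d` and `¬ (x ∼ d)`. -/
inductive ClockLit (X : Type*) where
  | pos (x : X) (r : ClockRel) (d : ℕ)
  | neg (x : X) (r : ClockRel) (d : ℕ)

/-- The clock of a literal. -/
def ClockLit.clock {X : Type*} : ClockLit X → X
  | .pos x _ _ => x
  | .neg x _ _ => x

/-- Truth value of the literal when its clock is replaced with the value `a`. -/
def ClockLit.holdsAt {X : Type*} : ClockLit X → ℝ≥0 → Prop
  | .pos _ r d, a => r.holds a d
  | .neg _ r d, a => ¬ r.holds a d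

/-- Weak truth value of the literal when its clock is replaced with the value `a`: `x < d` and
`x > d` are also satisfied by `d`, and `x = d` is never satisfied. -/
def ClockLit.weakHoldsAt {X : Type*} : ClockLit X → ℝ≥0 → Prop
  | .pos _ .lt d, a => a < d ∨ a = d
  | .pos _ .gt d, a => (d : ℝ≥0) < a ∨ a = d
  | .pos _ .eq _, _ => False
  | .neg _ .lt d, a => ¬ a < d
  | .neg _ .gt d, a => ¬ (d : ℝ≥0) < a
  | .neg _ .eq _, _ => True

/-- Clock constraints: conjunctions of literals. -/
abbrev ClockConstraint (X : Type*) := List (ClockLit X)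

/-- `v ⊨ γ`. -/
def ClockConstraint.Sat {X : Type*} (γ : ClockConstraint X) (v : X → ℝ≥0) : Prop :=
  ∀ β ∈ γ, β.holdsAt (v β.clock)

/-- The weak satisfaction relation `v ⊨_w γ`. -/
def ClockConstraint.WeakSat {X : Type*} (γ : ClockConstraint X) (v : X → ℝ≥0) : Prop :=
  ∀ β ∈ γ, β.weakHoldsAt (v β.clock)

/-- Variable constraints. -/
inductive VarConstraint (V : Type*) where
  | cmpConst (n : V) (r : Rel) (c : ℤ)
  | cmpVar (n : V) (r : Rel) (m : V)
  | not (ξ : VarConstraint V)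
  | and (ξ₁ ξ₂ : VarConstraint V)

/-- Satisfaction of a variable constraint. -/
def VarConstraint.Sat {V : Type*} (val : V → ℤ) : VarConstraint V → Prop
  | .cmpConst n r c => r.holds (val n) c
  | .cmpVar n r m => r.holds (val n) (val m)
  | .not ξ => ¬ ξ.Sat val
  | .and ξ₁ ξ₂ => ξ₁.Sat val ∧ ξ₂.Sat val

/-- Synchronization primitives `!`, `?`, `#`, `@`, `&`, `*`. -/
inductive Sync where
  | send
  | receive
  | broadcastSend
  | broadcastReceive
  | manySend
  | manyReceive

/-- The actions: the null event `none`, or a channel with a synchronization primitive. -/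
abbrev Action (Act : Type*) := Option (Act × Sync)

/-- Transitions `q → q'` with clock guard, variable guard, action, resets, and a finite set of
assignments `n := e`, listed as pairs `(n, e)`. -/
structure Transition (Q Act X V : Type*) where
  src : Q
  dst : Q
  guard : ClockConstraint X
  varGuard : VarConstraint V
  action : Action Act
  resets : Finset X
  assigns : List (V × Expr V)

/-- `n ∈ U(t)`: some assignment of `t` has `n` as its left-hand side. -/
def Transition.Updates {Q Act X V : Type*} (t : Transition Q Act X V) (n : V) : Prop :=
  ∃ a ∈ t.assigns, a.1 = n

/-- A timed automaton whose locations are numbered `0, …, lastLoc`, where `0` is the initial one,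
and whose transitions are numbered `0, …, numTrans - 1`. Invariants are convex. -/
structure Automaton (AP Act X V : Type*) where
  lastLoc : ℕ
  inv : Fin (lastLoc + 1) → ClockConstraint X
  label : Fin (lastLoc + 1) → Set AP
  numTrans : ℕ
  trans : Fin numTrans → Transition (Fin (lastLoc + 1)) Act X V
  inv_convex : ∀ q, Convex ℝ≥0 {v : X → ℝ≥0 | (inv q).Sat v}

/-- A network of `K` timed automata over the same propositions, actions, clocks and variables.
Variable `n` takes values in `dom n` and its initial value is `init n`. -/
structure Network (AP Act X V : Type*) (K : ℕ) where
  aut : Fin K → Automaton AP Act X V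
  dom : V → Set ℤ
  init : V → ℤ
  init_mem : ∀ n, init n ∈ dom n

/-- How a transition is taken: `ei` is open-closed `)[`, `ie` is closed-open `](`. -/
inductive Edge where
  | ei
  | ie

namespace Network

variable {AP Act X V : Type*} {K : ℕ} (N : Network AP Act X V K)

/-- Locations of automaton `k`. -/
abbrev Loc (k : Fin K) := Fin ((N.aut k).lastLoc + 1)

/-- Indices of the transitions of automaton `k`. -/
abbrev Tr (k : Fin K) := Fin (N.aut k).numTrans

/-- The transition of automaton `k` with index `t`. -/
abbrev tr (k : Fin K) (t : N.Tr k) : Transition (N.Loc k) Act X V := (N.aut k).trans t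

/-- The invariant of location `q` of automaton `k`. -/
abbrev inv (k : Fin K) (q : N.Loc k) : ClockConstraint X := (N.aut k).inv q

/-- Configurations. -/
structure Config where
  loc : ∀ k, N.Loc k
  var : V → ℤ
  clk : X → ℝ≥0

/-- The symbols of discrete transitions: `none` means that the automaton takes no transition. -/
abbrev Symbols (_ : Network AP Act X V K) := Fin K → Option (Action Act × Edge)

/-- The choice of a transition, or of no transition, in every automaton. -/
abbrev Choice := ∀ k, Option (N.Tr k)

variable {N}

/-- In the step from `c` to `c'` the automata can take exactly the transitions `τ`, with the actions
in `Λ`, as far as locations, guards, resets and assignments are concerned, and the clocks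
and variables that no taken transition resets or assigns keep their values. -/
def Fires (τ : N.Choice) (Λ : N.Symbols) (c c' : N.Config) : Prop :=
  (∀ k, Λ k = none → τ k = none ∧ c'.loc k = c.loc k) ∧
  (∀ k α b, Λ k = some (α, b) → ∃ t, τ k = some t ∧
    (N.tr k t).src = c.loc k ∧ (N.tr k t).dst = c'.loc k ∧ (N.tr k t).action = α ∧
    (N.tr k t).guard.Sat c.clk ∧ (N.tr k t).varGuard.Sat c.var ∧
    (∀ x ∈ (N.tr k t).resets, c'.clk x = 0) ∧
    (∀ a ∈ (N.tr k t).assigns, c'.var a.1 = a.2.eval c.var)) ∧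
  (∀ x, (∀ k t, τ k = some t → x ∉ (N.tr k t).resets) → c'.clk x = c.clk x) ∧
  (∀ n, (∀ k t, τ k = some t → ¬ (N.tr k t).Updates n) → c'.var n = c.var n)

/-- The invariants required by a discrete transition. -/
def StepInv (Λ : N.Symbols) (c c' : N.Config) : Prop :=
  ∀ k, match Λ k with
    | none => (N.inv k (c.loc k)).Sat c.clk ∧ (N.inv k (c'.loc k)).Sat c'.clk
    | some (_, .ei) => (N.inv k (c.loc k)).WeakSat c.clk ∧ (N.inv k (c'.loc k)).Sat c'.clk
    | some (_, .ie) => (N.inv k (c.loc k)).Sat c.clk ∧ (N.inv k (c'.loc k)).WeakSat c'.clk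

/-- Discrete transitions `c —Λ→ c'`. -/
def DiscreteStep (Λ : N.Symbols) (c c' : N.Config) : Prop :=
  (∃ τ, Fires τ Λ c c') ∧ StepInv Λ c c'

/-- Time transitions `c —δ→ c'`. -/
def TimeStep (δ : ℝ≥0) (c c' : N.Config) : Prop :=
  0 < δ ∧ c'.loc = c.loc ∧ c'.var = c.var ∧ (∀ x, c'.clk x = c.clk x + δ) ∧
  ∀ k, (N.inv k (c.loc k)).WeakSat c'.clk

variable (N)

/-- The labels of configuration changes. -/
inductive Event where
  | delay (δ : ℝ≥0)
  | disc (Λ : N.Symbols)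

variable {N}

/-- `e` is a discrete transition. -/
def Event.IsDisc : N.Event → Prop
  | .delay _ => False
  | .disc _ => True

/-- The duration of a time transition. -/
def Event.dur : N.Event → ℝ≥0
  | .delay δ => δ
  | .disc _ => 0

/-- The symbols of a discrete transition; a time transition has none. -/
def Event.symbols : N.Event → N.Symbols
  | .delay _ => fun _ => none
  | .disc Λ => Λ

/-- Configuration changes. -/
def Step : N.Event → N.Config → N.Config → Prop
  | .delay δ, c, c' => TimeStep δ c c'
  | .disc Λ, c, c' => DiscreteStep Λ c c'

variable (N)

/-- Infinite sequences `c₀, e₀, c₁, e₁, …` of configurations and labels. -/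
structure Run where
  conf : ℕ → N.Config
  ev : ℕ → N.Event

variable {N}

/-- Traces of the network. -/
structure IsTrace (η : N.Run) : Prop where
  dom : ∀ i n, (η.conf i).var n ∈ N.dom n
  step : ∀ i, Step (η.ev i) (η.conf i) (η.conf (i + 1))
  first : ¬ (η.ev 0).IsDisc
  init_loc : ∀ k, (η.conf 0).loc k = 0
  init_inv : ∀ k, (N.inv k ((η.conf 0).loc k)).Sat (η.conf 0).clk
  init_clk : ∀ x, (η.conf 0).clk x = 0
  init_var : ∀ n, (η.conf 0).var n = N.init n
  alternate : ∀ i, (η.ev i).IsDisc → ¬ (η.ev (i + 1)).IsDisc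

namespace Run

/-! A trace is given the form
`c₀ —δ₀→ c'₀ —Λ₀→ c₁ —δ₁→ c'₁ —Λ₁→ ⋯` by inserting, between two consecutive time transitions,
a discrete transition in which no automaton takes a transition. -/

/-- Position in the sequence of the `h`-th time transition. -/
noncomputable def pos (η : N.Run) : ℕ → ℕ
  | 0 => 0
  | h + 1 => open Classical in
      if (η.ev (η.pos h + 1)).IsDisc then η.pos h + 2 else η.pos h + 1

/-- The configuration `c_h`. -/
noncomputable def before (η : N.Run) (h : ℕ) : N.Config := η.conf (η.pos h)

/-- The configuration `c'_h`. -/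
noncomputable def mid (η : N.Run) (h : ℕ) : N.Config := η.conf (η.pos h + 1)

/-- The delay `δ_h`. -/
noncomputable def dur (η : N.Run) (h : ℕ) : ℝ≥0 := (η.ev (η.pos h)).dur

/-- The symbols `Λ_h`. -/
noncomputable def symbols (η : N.Run) (h : ℕ) : N.Symbols := (η.ev (η.pos h + 1)).symbols

end Run

/-! # The encoding of a network -/

end Network

/-- The propositions of the encoding: those of the network and `edge^{](}[k]`. -/
inductive EncProp (AP : Type*) (K : ℕ) where
  | ap (a : AP)
  | edge (k : Fin K)

/-- The clocks of the encoding: `(x, 0)` and `(x, 1)` are the two copies of clock `x`. -/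
abbrev EncClock (X : Type*) := X × Fin 2

/-- The integer variables of the encoding: `l[k]`, `t[k]`, the index `x_v` of the active copy of
clock `x`, and the variables of the network. -/
inductive EncVar (X V : Type*) (K : ℕ) where
  | loc (k : Fin K)
  | trans (k : Fin K)
  | active (x : X)
  | var (n : V)

/-- Formulae of the encoding. -/
abbrev EncFormula (AP X V : Type*) (K : ℕ) := Formula (EncProp AP K) (EncClock X) (EncVar X V K)

namespace Encoding

open CLTLoc.Formula

section Clocks

variable {AP X V : Type*} {K : ℕ}

/-- `x_j = 0`. -/
def copyZero (x : X) (j : Fin 2) : EncFormula AP X V K := .clock (x, j) .eq 0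

/-- `x_j > 0`. -/
def copyPos (x : X) (j : Fin 2) : EncFormula AP X V K :=
  .and (.not (.clock (x, j) .lt 0)) (.not (.clock (x, j) .eq 0))

/-- `x_v = j`. -/
def activeIs (x : X) (j : Fin 2) : EncFormula AP X V K := varEq (.active x) (j.val : ℤ)

/-- `x_0 = 0 ∨ x_1 = 0`: clock `x` is reset. -/
def isReset (x : X) : EncFormula AP X V K := or (copyZero x 0) (copyZero x 1)

/-- `x_j ∼ d`. -/
def copyCmp (x : X) (j : Fin 2) : ClockRel → ℕ → EncFormula AP X V K
  | .lt, d => .clock (x, j) .lt d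
  | .eq, d => .clock (x, j) .eq d
  | .gt, d => .and (.not (.clock (x, j) .lt d)) (.not (.clock (x, j) .eq d))

/-- `φ_{x ∼ d}`: the active copy of `x` satisfies the atomic constraint. -/
def encAtom (x : X) (r : ClockRel) (d : ℕ) : EncFormula AP X V K :=
  or (.and (copyCmp x 0 r d) (activeIs x 0)) (.and (copyCmp x 1 r d) (activeIs x 1))

/-- Encoding of a literal through the active copies. -/
def encLit : ClockLit X → EncFormula AP X V K
  | .pos x r d => encAtom x r d
  | .neg x r d => .not (encAtom x r d)

/-- The rewriting `r₁` on literals `β`: if the clock is reset then `β[x ← 0]`. -/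
noncomputable def r1Lit (β : ClockLit X) : EncFormula AP X V K :=
  imp (isReset β.clock) (ofProp (β.holdsAt 0))

/-- The rewriting `r₂` on literals `β`: if the clock is not reset then `β` on the active copy, and
if the clock is reset then `β[x ← 0]`. -/
noncomputable def r2Lit (β : ClockLit X) : EncFormula AP X V K :=
  .and (imp (.and (copyPos β.clock 0) (copyPos β.clock 1)) (encLit β))
    (imp (isReset β.clock) (ofProp (β.holdsAt 0)))

/-- Apply the rewriting `f` to the weak version of a literal: `x < d` becomes `x ≤ d`, `x > d`
becomes `x ≥ d`, and equalities become false. -/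
def weakLit (f : ClockLit X → EncFormula AP X V K) : ClockLit X → EncFormula AP X V K
  | .pos x .lt d => f (.neg x .gt d)
  | .pos x .gt d => f (.neg x .lt d)
  | .pos _ .eq _ => bot
  | .neg x .lt d => f (.neg x .lt d)
  | .neg x .gt d => f (.neg x .gt d)
  | .neg _ .eq _ => top

/-- The formula of a clock constraint. -/
def enc (γ : ClockConstraint X) : EncFormula AP X V K := bigAnd (γ.map encLit)

/-- The formula of the weak version of a clock constraint. -/
def encWeak (γ : ClockConstraint X) : EncFormula AP X V K := bigAnd (γ.map (weakLit encLit))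

/-- `r₁(γ)`. -/
noncomputable def r1 (γ : ClockConstraint X) : EncFormula AP X V K := bigAnd (γ.map r1Lit)

/-- `r₂(γ)`. -/
noncomputable def r2 (γ : ClockConstraint X) : EncFormula AP X V K := bigAnd (γ.map r2Lit)

/-- `r₂` applied to the weak version of `γ`. -/
noncomputable def r2Weak (γ : ClockConstraint X) : EncFormula AP X V K :=
  bigAnd (γ.map (weakLit r2Lit))

/-- The formula of a variable constraint. -/
def encVar : VarConstraint V → EncFormula AP X V K
  | .cmpConst n r c => .cmp (.var (.var n)) r (.const c)
  | .cmpVar n r m => .cmp (.var (.var n)) r (.var (.var m))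
  | .not ξ => .not (encVar ξ)
  | .and ξ₁ ξ₂ => .and (encVar ξ₁) (encVar ξ₂)

/-- The formula of a set of assignments `n := e`: the next value of `n` is the current value
of `e`. -/
def encAssigns (μ : List (V × Expr V)) : EncFormula AP X V K :=
  bigAnd (μ.map fun a => .nextCmp (.var a.1) .eq (a.2.map .var))

/-- The formula of a set of resets. -/
noncomputable def encResets (ζ : Finset X) : EncFormula AP X V K := all ζ isReset

variable [Fintype X]

/-- Initially, the copy `x_0` is active and `0`, and `x_1` is positive. -/
noncomputable def clockInit : EncFormula AP X V K :=
  all Finset.univ fun x : X => .and (copyZero x 0) (.and (copyPos x 1) (activeIs x 0))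

/-- After a reset, `x_j` is active and positive as long as the other copy is not reset. -/
noncomputable def clockSwitch (j : Fin 2) : EncFormula AP X V K :=
  all Finset.univ fun x : X =>
    imp (copyZero x j) (.next (release (copyZero x (j + 1)) (.and (activeIs x j) (copyPos x j))))

/-- The formula `φ_clock`. -/
noncomputable def clockFormula : EncFormula AP X V K :=
  .and clockInit (globally (.and (clockSwitch 0) (clockSwitch 1)))

end Clocks

variable {AP Act X V : Type*} {K : ℕ} (N : Network AP Act X V K)

/-- The integer that encodes taking a transition, or none of them (written `♮`), in
automaton `k`. -/
def code {k : Fin K} : Option (N.Tr k) → ℤ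
  | none => -1
  | some t => (t.val : ℤ)

/-- The domains of the integer variables of the encoding. -/
def dom : EncVar X V K → Set ℤ
  | .loc k => Set.range fun q : N.Loc k => (q.val : ℤ)
  | .trans k => Set.range (code N (k := k))
  | .active _ => {0, 1}
  | .var n => N.dom n

/-- Interpretations of the formulae of the encoding. -/
abbrev EncInterp := Interp (EncProp AP K) (EncClock X) (EncVar X V K) (dom N)

/-- `l[k] = q`. -/
def locIs (k : Fin K) (q : N.Loc k) : EncFormula AP X V K := varEq (.loc k) (q.val : ℤ)

/-- `t[k] = t`, or `t[k] = ♮`. -/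
def transIs (k : Fin K) (t : Option (N.Tr k)) : EncFormula AP X V K := varEq (.trans k) (code N t)

/-- Every automaton is in its initial location. -/
noncomputable def phi1 : EncFormula AP X V K := all Finset.univ fun k => locIs N k 0

/-- Every variable has its initial value. -/
noncomputable def phi2 [Fintype V] : EncFormula AP X V K :=
  all Finset.univ fun n : V => varEq (.var n) (N.init n)

/-- The invariants of the current locations hold. -/
noncomputable def phi3 : EncFormula AP X V K :=
  all Finset.univ fun k => all Finset.univ fun q => imp (locIs N k q) (enc (N.inv k q))

/-- Automata that take no transition. -/
noncomputable def phi4 : EncFormula AP X V K :=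
  all Finset.univ fun k => all Finset.univ fun q =>
    imp (.and (locIs N k q) (transIs N k none))
      (.next (.and (enc (N.inv k q)) (r1 (N.inv k q))))

/-- Invariants of the source `a` and the destination `b` in a closed-open or open-closed
transition. -/
noncomputable def phiEdge (k : Fin K) (a b : N.Loc k) : EncFormula AP X V K :=
  or (.and (enc (N.inv k a)) (.and (r2Weak (N.inv k b)) (.prop (.edge k))))
    (.and (encWeak (N.inv k a)) (.and (r2 (N.inv k b)) (.not (.prop (.edge k)))))

/-- Automata that take a transition. -/
noncomputable def phi5 : EncFormula AP X V K :=
  all Finset.univ fun k => all Finset.univ fun t : N.Tr k =>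
    imp (transIs N k (some t))
      (.and (locIs N k (N.tr k t).src)
      (.and (encVar (N.tr k t).varGuard)
      (.and (encAssigns (N.tr k t).assigns)
        (.next
          (.and (locIs N k (N.tr k t).dst)
          (.and (enc (N.tr k t).guard)
          (.and (encResets (N.tr k t).resets)
            (phiEdge N k (N.tr k t).src (N.tr k t).dst))))))))

open Classical in
/-- Locations change only by transitions. -/
noncomputable def phi6 : EncFormula AP X V K :=
  all Finset.univ fun k => all Finset.univ fun q => all {q' : N.Loc k | q ≠ q'} fun q' =>
    imp (.and (locIs N k q) (.next (locIs N k q')))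
      (any {t : N.Tr k | (N.tr k t).src = q ∧ (N.tr k t).dst = q'} fun t => transIs N k (some t))

open Classical in
/-- Clocks are reset only by transitions. -/
noncomputable def phi7 [Fintype X] : EncFormula AP X V K :=
  all Finset.univ fun x : X =>
    imp (.next (isReset x))
      (any Finset.univ fun k => any {t : N.Tr k | x ∈ (N.tr k t).resets} fun t =>
        transIs N k (some t))

open Classical in
/-- Variables change only by transitions. -/
noncomputable def phi8 [Fintype V] : EncFormula AP X V K :=
  all Finset.univ fun n : V =>
    imp (.not (.nextCmp (.var n) .eq (.var (.var n))))
      (any Finset.univ fun k => any {t : N.Tr k | (N.tr k t).Updates n} fun t =>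
        transIs N k (some t))

/-- The formula `φ_N` of the network. -/
noncomputable def phiN [Fintype X] [Fintype V] : EncFormula AP X V K :=
  .and clockFormula
  (.and (phi1 N) (.and (phi2 N) (.and (phi3 N)
    (globally (.and (phi4 N) (.and (phi5 N) (.and (phi6 N) (.and (phi7 N) (phi8 N)))))))))

/-! # The correspondence between traces and interpretations -/

variable {N}

/-- The active copy of clock `x` at position `h`. -/
def activeCopy (M : EncInterp N) (h : ℕ) (x : X) : Fin 2 :=
  if M.ι h (.active x) = 1 then 1 else 0

/-- `M ∈ ρ(η)`. Clock `x` is reset at position `h + 1` of the trace exactly if its value there is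
`0`, because a positive delay comes before every discrete transition. The value of `edge^{](}[k]`
is arbitrary at position `0` and at the positions where automaton `k` takes no transition. -/
structure InRho (η : N.Run) (M : EncInterp N) : Prop where
  loc : ∀ h k, M.ι h (.loc k) = (((η.before h).loc k).val : ℤ)
  var : ∀ h n, M.ι h (.var n) = (η.before h).var n
  ap : ∀ h a, .ap a ∈ M.π h ↔ ∃ k, a ∈ (N.aut k).label ((η.before h).loc k)
  clk_zero : ∀ x, M.σ 0 (x, 0) = 0 ∧ 0 < M.σ 0 (x, 1)
  act_zero : ∀ x, M.ι 0 (.active x) = 0 ∧ M.ι 1 (.active x) = 0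
  clk_active : ∀ h x,
    M.σ (h + 1) (x, activeCopy M (h + 1) x) = M.σ h (x, activeCopy M (h + 1) x) + η.dur h
  clk_inactive : ∀ h x,
    ((η.before (h + 1)).clk x = 0 → M.σ (h + 1) (x, activeCopy M (h + 1) x + 1) = 0) ∧
    ((η.before (h + 1)).clk x ≠ 0 →
      M.σ (h + 1) (x, activeCopy M (h + 1) x + 1) =
        M.σ h (x, activeCopy M (h + 1) x + 1) + η.dur h)
  act_succ : ∀ h x,
    ((η.before (h + 1)).clk x = 0 →
      M.ι (h + 2) (.active x) = (M.ι (h + 1) (.active x) + 1) % 2) ∧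
    ((η.before (h + 1)).clk x ≠ 0 → M.ι (h + 2) (.active x) = M.ι (h + 1) (.active x))
  trans : ∀ h, ∃ τ : N.Choice, Network.Fires τ (η.symbols h) (η.mid h) (η.before (h + 1)) ∧
    ∀ k, M.ι h (.trans k) = code N (τ k)
  edge : ∀ h k α b, η.symbols h k = some (α, b) → (.edge k ∈ M.π (h + 1) ↔ b = Edge.ie)

/-- The set `ρ(η)` of interpretations. -/
def rho (η : N.Run) : Set (EncInterp N) := {M | InRho η M}

/-- The location encoded by the value of `l[k]`. -/
def decodeLoc (k : Fin K) (z : ℤ) : N.Loc k := Fin.ofNat _ z.toNat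

/-- The transition encoded by the value of `t[k]`. -/
def decodeTrans (k : Fin K) (z : ℤ) : Option (N.Tr k) :=
  if 0 ≤ z then (if h : z.toNat < (N.aut k).numTrans then some ⟨z.toNat, h⟩ else none) else none

open Classical in
/-- The symbols `Λ_h` of `ρ⁻¹(M)`. -/
noncomputable def invSymbols (M : EncInterp N) (h : ℕ) : N.Symbols := fun k =>
  (decodeTrans k (M.ι h (.trans k))).map fun t =>
    ((N.tr k t).action, if .edge k ∈ M.π (h + 1) then Edge.ie else Edge.ei)

open Classical in
/-- The configuration `c_h` of `ρ⁻¹(M)`. -/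
noncomputable def invBefore (M : EncInterp N) (h : ℕ) : N.Config where
  loc k := decodeLoc k (M.ι h (.loc k))
  var n := M.ι h (.var n)
  clk x := if M.σ h (x, 0) = 0 ∨ M.σ h (x, 1) = 0 then 0 else M.σ h (x, activeCopy M h x)

/-- The configuration `c'_h` of `ρ⁻¹(M)`. -/
noncomputable def invMid (M : EncInterp N) (h : ℕ) : N.Config where
  loc k := decodeLoc k (M.ι h (.loc k))
  var n := M.ι h (.var n)
  clk x := M.σ (h + 1) (x, activeCopy M (h + 1) x)

/-- `ρ⁻¹(M)`: the sequence `c₀, δ₀, c'₀, Λ₀, c₁, δ₁, c'₁, Λ₁, …`. -/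
noncomputable def rhoInv (M : EncInterp N) : N.Run where
  conf i := if i % 2 = 0 then invBefore M (i / 2) else invMid M (i / 2)
  ev i := if i % 2 = 0 then .delay (M.delay (i / 2)) else .disc (invSymbols M (i / 2))

end Encoding

end TANet

/-!
The correspondence is proved by decoding an interpretation `M` into the configurations
`invBefore M h` and `invMid M h` and the symbols `invSymbols M h`, and by reading `φ_N` as a
statement about them.

* `φ_clock` forces the two copies of a clock to take turns (`sat_clockFormula_iff`): a copy that
  is reset becomes active at the next position and stays active and positive up to and including
  the next reset of the other copy. So, at position `h + 1`, the active copy carries the value of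
  the clock after the `h`-th delay and before any reset (`invMid M h`), while the other copy
  records whether the clock is reset there. At that position, literals of `φ_N` are evaluated in
  `invMid M h`, and literals rewritten by `r₂`, or by `r₁` next to the original constraint, in
  `invBefore M (h + 1)`.
* Hence `φ₄ ∧ … ∧ φ₈` holds at `h` if and only if the decoded transitions lead from `invMid M h`
  to `invBefore M (h + 1)` and respect the invariants (`sat_stepFormula`). Models of `φ_N` are
  thus the interpretations with correct clock copies whose decoding starts in the initial
  configuration and makes a discrete step at every position (`isModel_phiN_iff`).

In a model, the discrete steps guarantee the invariant of a location, strongly or weakly, at both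
ends of each delay. This gives the weak invariant demanded by a time transition
(`timeStep_of_inv`), because strong satisfaction fails to imply weak satisfaction only for
literals `x = d`, and these cannot hold at both ends of a positive delay.

If `M ∈ ρ(η)`, then the decoding of `M` is `η` itself (`invBefore_eq`, `invMid_eq`,
`invSymbols_eq`), so what remains is that every step of `η` respects the invariants in the
required form (`IsTrace.stepInv`). Only the idle steps inserted between two consecutive delays
need an argument: there the network guarantees the invariant weakly, and `φ₄` asks for it
strongly. The invariant holds weakly at three successive times. Hence it holds strongly at all
but finitely many of the times between the first and the last, the exceptions coming from literals
`¬ (x = d)`. Such times exist on both sides of the middle one, so by convexity the invariant holds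
strongly at the middle one, too
(`ClockConstraint.sat_of_weakSat_of_convex`).
-/

open CLTLoc CLTLoc.Formula

/-! ### Satisfaction of the derived connectives -/

namespace CLTLoc.Interp

variable {P C V : Type*} {D : V → Set ℤ} (M : Interp P C V D) (i : ℕ)

@[simp] lemma sat_and (φ ψ : Formula P C V) : M.Sat i (.and φ ψ) ↔ M.Sat i φ ∧ M.Sat i ψ := Iff.rfl

@[simp] lemma sat_not (φ : Formula P C V) : M.Sat i (.not φ) ↔ ¬ M.Sat i φ := Iff.rfl

@[simp] lemma sat_next (φ : Formula P C V) : M.Sat i (.next φ) ↔ M.Sat (i + 1) φ := Iff.rfl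

@[simp] lemma sat_prop (p : P) : M.Sat i (.prop p) ↔ p ∈ M.π i := Iff.rfl

@[simp] lemma sat_top : M.Sat i top := rfl

@[simp] lemma sat_bot : ¬ M.Sat i bot := fun h => h rfl

@[simp] lemma sat_or (φ ψ : Formula P C V) : M.Sat i (or φ ψ) ↔ M.Sat i φ ∨ M.Sat i ψ := by
  simp only [Formula.or, sat_not, sat_and]
  tauto

@[simp] lemma sat_imp (φ ψ : Formula P C V) : M.Sat i (imp φ ψ) ↔ (M.Sat i φ → M.Sat i ψ) := by
  simp only [Formula.imp, sat_or, sat_not]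
  tauto

@[simp] lemma sat_globally (φ : Formula P C V) :
    M.Sat i (globally φ) ↔ ∀ j, i ≤ j → M.Sat j φ := by
  simp [Formula.globally, Formula.eventually, Interp.Sat, Formula.top, Rel.holds]

@[simp] lemma sat_release (φ ψ : Formula P C V) :
    M.Sat i (release φ ψ) ↔
      ∀ j, i ≤ j → (∀ m, i ≤ m → m < j → ¬ M.Sat m φ) → M.Sat j ψ := by
  simp only [Formula.release, Interp.Sat, not_exists, not_and]
  exact forall₂_congr fun j _ => by tauto

@[simp] lemma sat_bigAnd (l : List (Formula P C V)) :
    M.Sat i (bigAnd l) ↔ ∀ φ ∈ l, M.Sat i φ := by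
  induction l with
  | nil => simp [bigAnd]
  | cons φ l ih => simp [bigAnd, ih]

@[simp] lemma sat_bigOr (l : List (Formula P C V)) :
    M.Sat i (bigOr l) ↔ ∃ φ ∈ l, M.Sat i φ := by
  induction l with
  | nil => simp [bigOr]
  | cons φ l ih => simp [bigOr, ih]

@[simp] lemma sat_all {I : Type*} (s : Finset I) (f : I → Formula P C V) :
    M.Sat i (all s f) ↔ ∀ a ∈ s, M.Sat i (f a) := by
  simp [all]

@[simp] lemma sat_any {I : Type*} (s : Finset I) (f : I → Formula P C V) :
    M.Sat i (any s f) ↔ ∃ a ∈ s, M.Sat i (f a) := by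
  simp [any]

@[simp] lemma sat_ofProp (p : Prop) : M.Sat i (ofProp p) ↔ p := by
  by_cases h : p <;> simp [ofProp, h]

@[simp] lemma sat_varEq (n : V) (c : ℤ) : M.Sat i (varEq n c) ↔ M.ι i n = c := Iff.rfl

end CLTLoc.Interp

lemma CLTLoc.Expr.eval_map {V W : Type*} (f : V → W) (val : W → ℤ) (e : Expr V) :
    (e.map f).eval val = e.eval (val ∘ f) := by
  induction e <;> simp_all [Expr.map, Expr.eval]

/-! ### Strong and weak satisfaction along a delay -/

namespace TANet

variable {X : Type*}

/-- A literal other than `x = d` that holds also holds weakly, and the literal `x = d` does not hold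
for two different values of `x`, such as those before and after a delay. -/
lemma ClockLit.weakHoldsAt_of_ne {β : ClockLit X} {a b : ℝ≥0} (hab : a ≠ b)
    (ha : β.holdsAt a ∨ β.weakHoldsAt a) (hb : β.holdsAt b ∨ β.weakHoldsAt b) :
    β.weakHoldsAt a := by
  rcases β with ⟨x, _ | _ | _, d⟩ | ⟨x, _ | _ | _, d⟩ <;>
    simp only [holdsAt, weakHoldsAt, ClockRel.holds, or_false] at * <;> try tauto
  exact hab (ha.trans hb.symm)

lemma ClockConstraint.weakSat_of_ne {γ : ClockConstraint X} {v v' : X → ℝ≥0}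
    (hne : ∀ x, v x ≠ v' x) (hv : γ.Sat v ∨ γ.WeakSat v) (hv' : γ.Sat v' ∨ γ.WeakSat v') :
    γ.WeakSat v := fun β hβ =>
  ClockLit.weakHoldsAt_of_ne (hne β.clock) (hv.imp (· β hβ) (· β hβ)) (hv'.imp (· β hβ) (· β hβ))

/-- Strictly between two values at which a literal holds weakly, the literal holds, unless it is
`¬ (x = d)` and the clock has the value `d` there. -/
lemma ClockLit.holdsAt_of_weakHoldsAt {β : ClockLit X} {a t s : ℝ≥0} (ha : β.weakHoldsAt a)
    (hs : β.weakHoldsAt (a + s)) (h0 : 0 < t) (hts : t < s)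
    (hne : ∀ x d, β = .neg x .eq d → a + t ≠ d) : β.holdsAt (a + t) := by
  have h1 : a < a + t := lt_add_of_pos_right a h0
  have h2 : a + t < a + s := by gcongr
  rcases β with ⟨x, _ | _ | _, d⟩ | ⟨x, _ | _ | _, d⟩ <;>
    simp only [holdsAt, weakHoldsAt, ClockRel.holds, not_lt] at *
  · exact h2.trans_le (le_of_lt_or_eq hs)
  · exact (le_of_lt_or_eq (ha.imp_right Eq.symm)).trans_lt h1
  · exact ha.trans h1.le
  · exact hne x d rfl
  · exact h2.le.trans hs

/-- A convex constraint that holds weakly at both ends of a delay holds at every time strictly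
between. The literals `¬ (x = d)`, whose weak form is void, fail at finitely many times only, so
that on both sides of the given time there is a time at which the whole constraint holds. -/
lemma ClockConstraint.sat_of_weakSat_of_convex {γ : ClockConstraint X}
    (hγ : Convex ℝ≥0 {v : X → ℝ≥0 | γ.Sat v}) {v v₁ v₂ : X → ℝ≥0} {t s : ℝ≥0} (ht : 0 < t)
    (hs : 0 < s) (hv₁ : ∀ x, v₁ x = v x + t) (hv₂ : ∀ x, v₂ x = v₁ x + s)
    (h : γ.WeakSat v) (h₂ : γ.WeakSat v₂) : γ.Sat v₁ := by
  -- the delays after which some literal `¬ (x = d)` of the constraint is violated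
  let bad : Set ℝ≥0 := ⋃ β ∈ {β | β ∈ γ}, {r | ∃ x d, β = .neg x .eq d ∧ v x + r = d}
  have hbad : bad.Finite := by
    refine Set.Finite.biUnion (List.finite_toSet γ) fun β _ => Set.Subsingleton.finite ?_
    rintro r ⟨x, d, rfl, hr⟩ r' ⟨x', d', hx, hr'⟩
    simp only [ClockLit.neg.injEq, true_and] at hx
    obtain ⟨rfl, rfl⟩ := hx
    exact add_left_cancel (hr.trans hr'.symm)
  have key : ∀ r, 0 < r → r < t + s → r ∉ bad → γ.Sat fun x => v x + r := by
    intro r h0 hr hb β hβ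
    refine ClockLit.holdsAt_of_weakHoldsAt (s := t + s) (h β hβ) ?_ h0 hr ?_
    · rw [← add_assoc, ← hv₁, ← hv₂]
      exact h₂ β hβ
    · rintro x d rfl hd
      exact hb (Set.mem_biUnion (show ClockLit.neg x .eq d ∈ {β | β ∈ γ} from hβ) ⟨x, d, rfl, hd⟩)
  obtain ⟨r₁, ⟨h0, hr₁⟩, hb₁⟩ := ((Set.Ioo_infinite ht).sdiff hbad).nonempty
  obtain ⟨r₂, ⟨hr₂, hr₂'⟩, hb₂⟩ :=
    ((Set.Ioo_infinite (lt_add_of_pos_right t hs)).sdiff hbad).nonempty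
  obtain ⟨p, rfl⟩ := exists_add_of_le hr₁.le
  obtain ⟨q, rfl⟩ := exists_add_of_le hr₂.le
  have hp : 0 < p := pos_of_lt_add_right hr₁
  have hpq : p + q ≠ 0 := (add_pos_of_pos_of_nonneg hp zero_le).ne'
  have hsum : q / (p + q) + p / (p + q) = 1 := by
    rw [← add_div, add_comm q, div_self hpq]
  have h₁ : (fun x => v x + r₁) ∈ {v | γ.Sat v} :=
    key r₁ h0 (hr₁.trans (lt_add_of_pos_right _ hs)) hb₁
  have h₂ : (fun x => v x + (r₁ + p + q)) ∈ {v | γ.Sat v} :=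
    key _ (h0.trans (hr₁.trans hr₂)) hr₂' hb₂
  have hv : v₁ = (q / (p + q)) • (fun x => v x + r₁) +
      (p / (p + q)) • fun x => v x + (r₁ + p + q) := by
    funext x
    simp only [Pi.add_apply, Pi.smul_apply, smul_eq_mul, hv₁]
    field_simp
    ring
  rw [hv]
  exact hγ h₁ h₂ zero_le zero_le hsum

end TANet

namespace TANet.Encoding

open TANet.Network

variable {AP Act X V : Type*} {K : ℕ} {N : Network AP Act X V K} (M : EncInterp N) (h : ℕ)

/-! ### Decoding an interpretation -/

/-- The value of the active copies of the clocks at a position. At `h + 1` it is the clock valuation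
of `c'_h`, the configuration after the `h`-th delay and before any reset. -/
def activeVal (x : X) : ℝ≥0 := M.σ h (x, activeCopy M h x)

/-- The transitions encoded by the values of `t[k]`. -/
def choice : N.Choice := fun k => decodeTrans k (M.ι h (.trans k))

@[simp] lemma invMid_clk : (invMid M h).clk = activeVal M (h + 1) := rfl

lemma invMid_loc : (invMid M h).loc = (invBefore M h).loc := rfl

lemma invMid_var : (invMid M h).var = (invBefore M h).var := rfl

@[simp] lemma decodeTrans_code {k : Fin K} (t : Option (N.Tr k)) :
    decodeTrans k (code N t) = t := by
  cases t with
  | none => simp [code, decodeTrans]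
  | some t => simp [code, decodeTrans]

@[simp] lemma decodeLoc_val {k : Fin K} (q : N.Loc k) : decodeLoc k (q.val : ℤ) = q := by
  simp [decodeLoc]

lemma code_choice (k : Fin K) : M.ι h (.trans k) = code N (choice M h k) := by
  obtain ⟨t, ht⟩ : M.ι h (.trans k) ∈ Set.range (code N (k := k)) := M.mem_dom h (.trans k)
  rw [choice, ← ht, decodeTrans_code]

lemma loc_val_invBefore (k : Fin K) : M.ι h (.loc k) = (((invBefore M h).loc k).val : ℤ) := by
  obtain ⟨q, hq⟩ : M.ι h (.loc k) ∈ Set.range fun q : N.Loc k => (q.val : ℤ) :=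
    M.mem_dom h (.loc k)
  simp only [invBefore, ← hq, decodeLoc_val]

/-! ### Satisfaction of the formulae of the encoding -/

@[simp] lemma sat_locIs (k : Fin K) (q : N.Loc k) :
    M.Sat h (locIs N k q) ↔ (invBefore M h).loc k = q := by
  rw [locIs, Interp.sat_varEq, loc_val_invBefore, Nat.cast_inj, Fin.val_inj]

@[simp] lemma sat_transIs (k : Fin K) (t : Option (N.Tr k)) :
    M.Sat h (transIs N k t) ↔ choice M h k = t := by
  rw [transIs, Interp.sat_varEq, code_choice]
  refine ⟨fun e => ?_, fun e => by rw [e]⟩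
  rw [← decodeTrans_code (choice M h k), e, decodeTrans_code]

@[simp] lemma sat_activeIs (x : X) (j : Fin 2) :
    M.Sat h (activeIs x j) ↔ activeCopy M h x = j := by
  rw [activeIs, Interp.sat_varEq, activeCopy]
  have hd : M.ι h (.active x) = 0 ∨ M.ι h (.active x) = 1 := M.mem_dom h (.active x)
  rcases hd with hd | hd <;> fin_cases j <;> simp [hd]

@[simp] lemma sat_copyZero (x : X) (j : Fin 2) :
    M.Sat h (copyZero x j) ↔ M.σ h (x, j) = 0 := by
  simp [copyZero, Interp.Sat, Rel.holds]

@[simp] lemma sat_copyPos (x : X) (j : Fin 2) :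
    M.Sat h (copyPos x j) ↔ 0 < M.σ h (x, j) := by
  simp [copyPos, Interp.Sat, Rel.holds, pos_iff_ne_zero]

@[simp] lemma sat_isReset (x : X) :
    M.Sat h (isReset x) ↔ M.σ h (x, 0) = 0 ∨ M.σ h (x, 1) = 0 := by
  simp [isReset]

lemma sat_copyCmp (x : X) (j : Fin 2) (r : ClockRel) (d : ℕ) :
    M.Sat h (copyCmp x j r d) ↔ r.holds (M.σ h (x, j)) d := by
  cases r
  · exact Iff.rfl
  · exact Iff.rfl
  · simp only [copyCmp, Interp.Sat, Rel.holds, ClockRel.holds, ← not_or, ← le_iff_lt_or_eq, not_le]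

lemma sat_encAtom (x : X) (r : ClockRel) (d : ℕ) :
    M.Sat h (encAtom x r d) ↔ r.holds (activeVal M h x) d := by
  simp only [encAtom, Interp.sat_or, Interp.sat_and, sat_copyCmp, sat_activeIs, activeVal]
  generalize activeCopy M h x = j
  fin_cases j <;> simp

@[simp] lemma sat_encLit (β : ClockLit X) :
    M.Sat h (encLit β) ↔ β.holdsAt (activeVal M h β.clock) := by
  cases β <;> simp [encLit, sat_encAtom, ClockLit.holdsAt, ClockLit.clock]

@[simp] lemma sat_enc (γ : ClockConstraint X) :
    M.Sat h (enc γ) ↔ γ.Sat (activeVal M h) := by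
  simp [enc, ClockConstraint.Sat]

/-- The weak version of a literal is sound for every encoding of literals that evaluates them at a
given value of the clock. -/
lemma sat_weakLit {f : ClockLit X → EncFormula AP X V K} {v : X → ℝ≥0}
    (hf : ∀ β, M.Sat h (f β) ↔ β.holdsAt (v β.clock)) (β : ClockLit X) :
    M.Sat h (weakLit f β) ↔ β.weakHoldsAt (v β.clock) := by
  rcases β with ⟨x, _ | _ | _, d⟩ | ⟨x, _ | _ | _, d⟩ <;>
    simp [weakLit, hf, ClockLit.holdsAt, ClockLit.weakHoldsAt, ClockLit.clock, ClockRel.holds,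
      le_iff_lt_or_eq, eq_comm]

@[simp] lemma sat_encWeak (γ : ClockConstraint X) :
    M.Sat h (encWeak γ) ↔ γ.WeakSat (activeVal M h) := by
  simp [encWeak, ClockConstraint.WeakSat, sat_weakLit M h (sat_encLit M h)]

lemma invBefore_clk_of_reset {x : X} (hx : M.σ h (x, 0) = 0 ∨ M.σ h (x, 1) = 0) :
    (invBefore M h).clk x = 0 := if_pos hx

lemma invBefore_clk_of_not_reset {x : X} (hx : ¬ (M.σ h (x, 0) = 0 ∨ M.σ h (x, 1) = 0)) :
    (invBefore M h).clk x = activeVal M h x := if_neg hx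

@[simp] lemma sat_r2Lit (β : ClockLit X) :
    M.Sat h (r2Lit β) ↔ β.holdsAt ((invBefore M h).clk β.clock) := by
  simp only [r2Lit, Interp.sat_and, Interp.sat_imp, sat_copyPos, sat_encLit, sat_isReset,
    Interp.sat_ofProp, pos_iff_ne_zero, ← not_or]
  by_cases hx : M.σ h (β.clock, 0) = 0 ∨ M.σ h (β.clock, 1) = 0
  · simp [hx, invBefore_clk_of_reset M h hx]
  · simp [hx, invBefore_clk_of_not_reset M h hx]

@[simp] lemma sat_r2 (γ : ClockConstraint X) :
    M.Sat h (r2 γ) ↔ γ.Sat (invBefore M h).clk := by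
  simp [r2, ClockConstraint.Sat]

@[simp] lemma sat_r2Weak (γ : ClockConstraint X) :
    M.Sat h (r2Weak γ) ↔ γ.WeakSat (invBefore M h).clk := by
  simp [r2Weak, ClockConstraint.WeakSat, sat_weakLit M h (sat_r2Lit M h)]

/-- Together with the constraint itself, which speaks of the values before the resets, `r₁`
expresses that the constraint also holds after the resets. -/
lemma sat_enc_and_r1 (γ : ClockConstraint X) :
    M.Sat h (enc γ) ∧ M.Sat h (r1 γ) ↔
      γ.Sat (activeVal M h) ∧ γ.Sat (invBefore M h).clk := by
  rw [sat_enc, and_congr_right_iff]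
  intro hγ
  simp only [r1, Interp.sat_bigAnd, List.forall_mem_map, ClockConstraint.Sat]
  refine forall₂_congr fun β hβ => ?_
  simp only [r1Lit, Interp.sat_imp, sat_isReset, Interp.sat_ofProp]
  by_cases hx : M.σ h (β.clock, 0) = 0 ∨ M.σ h (β.clock, 1) = 0
  · simp [hx, invBefore_clk_of_reset M h hx]
  · simp [hx, invBefore_clk_of_not_reset M h hx, hγ β hβ]

@[simp] lemma sat_encVar (ξ : VarConstraint V) :
    M.Sat h (encVar ξ) ↔ ξ.Sat (invBefore M h).var := by
  induction ξ with
  | cmpConst n r c => rfl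
  | cmpVar n r m => rfl
  | not ξ ih => simp [encVar, VarConstraint.Sat, ih]
  | and ξ₁ ξ₂ ih₁ ih₂ => simp [encVar, VarConstraint.Sat, ih₁, ih₂]

@[simp] lemma sat_encAssigns (μ : List (V × Expr V)) :
    M.Sat h (encAssigns μ) ↔
      ∀ a ∈ μ, (invBefore M (h + 1)).var a.1 = a.2.eval (invBefore M h).var := by
  simp only [encAssigns, Interp.sat_bigAnd, List.forall_mem_map]
  refine forall₂_congr fun a _ => ?_
  simp only [Interp.Sat, Expr.eval_map]
  rfl

@[simp] lemma sat_nextCmp_self (n : V) :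
    M.Sat h (.nextCmp (.var n) .eq (.var (.var n))) ↔
      (invBefore M (h + 1)).var n = (invBefore M h).var n := Iff.rfl

/-! ### The clock formula -/

/-- The behaviour of the two copies of the clocks: the active copy is positive after every delay,
and the roles of the copies are exchanged after exactly the positions where the inactive one
is `0`. -/
structure IsSwitching : Prop where
  zero : ∀ x, M.σ 0 (x, 0) = 0
  pos : ∀ x, 0 < M.σ 0 (x, 1)
  active_zero : ∀ x, activeCopy M 0 x = 0
  active_one : ∀ x, activeCopy M 1 x = 0
  activeVal_pos : ∀ h x, 0 < activeVal M (h + 1) x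
  switch : ∀ h x, M.σ (h + 1) (x, activeCopy M (h + 1) x + 1) = 0 →
    activeCopy M (h + 2) x = activeCopy M (h + 1) x + 1
  keep : ∀ h x, M.σ (h + 1) (x, activeCopy M (h + 1) x + 1) ≠ 0 →
    activeCopy M (h + 2) x = activeCopy M (h + 1) x

lemma fin_two_eq_or (i j : Fin 2) : j = i ∨ j = i + 1 := by
  fin_cases i <;> fin_cases j <;> simp

lemma sat_clockFormula_iff_forall_reset [Fintype X] :
    M.Sat 0 clockFormula ↔
      (∀ x, M.σ 0 (x, 0) = 0 ∧ 0 < M.σ 0 (x, 1) ∧ activeCopy M 0 x = 0) ∧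
      ∀ h j x, M.σ h (x, j) = 0 → ∀ m, h + 1 ≤ m →
        (∀ i, h + 1 ≤ i → i < m → M.σ i (x, j + 1) ≠ 0) →
          activeCopy M m x = j ∧ 0 < M.σ m (x, j) := by
  simp [clockFormula, clockInit, clockSwitch]

/-- `φ_clock` says that after a reset of one copy this copy is active and positive up to and
including the next reset of the other one. So at every position after the first the active copy is
the one that was reset last at an earlier position. -/
lemma sat_clockFormula_iff [Fintype X] : M.Sat 0 clockFormula ↔ IsSwitching M := by
  rw [sat_clockFormula_iff_forall_reset]
  constructor
  · rintro ⟨h0, hsw⟩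
    have act1 : ∀ x, activeCopy M 1 x = 0 := fun x =>
      (hsw 0 0 x (h0 x).1 1 le_rfl (by omega)).1
    -- `g` is the last reset, at or before `h`, of the copy that is active at `h + 1`
    have last : ∀ h x, ∃ g ≤ h, M.σ g (x, activeCopy M (h + 1) x) = 0 ∧
        ∀ i, g + 1 ≤ i → i < h + 1 → M.σ i (x, activeCopy M (h + 1) x + 1) ≠ 0 := by
      intro h x
      induction h with
      | zero => exact ⟨0, le_rfl, by rw [act1]; exact (h0 x).1, by omega⟩
      | succ h ih =>
        obtain ⟨g, hg, hz, hi⟩ := ih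
        by_cases hr : M.σ (h + 1) (x, activeCopy M (h + 1) x + 1) = 0
        · refine ⟨h + 1, le_rfl, ?_, by omega⟩
          rwa [(hsw (h + 1) _ x hr (h + 2) le_rfl (by omega)).1]
        · have hi' : ∀ i, g + 1 ≤ i → i < h + 2 →
              M.σ i (x, activeCopy M (h + 1) x + 1) ≠ 0 := by
            intro i hgi hih
            rcases Nat.lt_succ_iff_lt_or_eq.1 hih with hlt | rfl
            exacts [hi i hgi hlt, hr]
          have hact := (hsw g _ x hz (h + 2) (by omega) hi').1
          exact ⟨g, by omega, by rwa [hact], by rwa [hact]⟩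
    refine ⟨fun x => (h0 x).1, fun x => (h0 x).2.1, fun x => (h0 x).2.2, act1, ?_, ?_, ?_⟩
    · intro h x
      obtain ⟨g, hg, hz, hi⟩ := last h x
      exact (hsw g _ x hz (h + 1) (by omega) hi).2
    · intro h x hr
      exact (hsw (h + 1) _ x hr (h + 2) le_rfl (by omega)).1
    · intro h x hr
      obtain ⟨g, hg, hz, hi⟩ := last h x
      refine (hsw g _ x hz (h + 2) (by omega) fun i hgi hih => ?_).1
      rcases Nat.lt_succ_iff_lt_or_eq.1 hih with hlt | rfl
      exacts [hi i hgi hlt, hr]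
  · intro H
    refine ⟨fun x => ⟨H.zero x, H.pos x, H.active_zero x⟩, fun h j x hz m hm hne => ?_⟩
    have hact : activeCopy M m x = j := by
      induction m, hm using Nat.le_induction with
      | base =>
        rcases h with _ | h
        · rw [H.active_one]
          rcases fin_two_eq_or 0 j with rfl | rfl
          exacts [rfl, absurd hz (H.pos x).ne']
        · rcases fin_two_eq_or (activeCopy M (h + 1) x) j with rfl | rfl
          exacts [absurd hz (H.activeVal_pos h x).ne', H.switch h x hz]
      | succ m hm ih =>
        obtain ⟨m, rfl⟩ := Nat.exists_eq_add_of_le' (show 1 ≤ m by omega)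
        have ih := ih fun i hi him => hne i hi (by omega)
        rw [H.keep m x (by rw [ih]; exact hne (m + 1) hm (by omega)), ih]
    refine ⟨hact, ?_⟩
    obtain ⟨m, rfl⟩ := Nat.exists_eq_add_of_le' (show 1 ≤ m by omega)
    have := H.activeVal_pos m x
    rwa [activeVal, hact] at this

variable {M}

namespace IsSwitching

lemma reset_iff (H : IsSwitching M) (h : ℕ) (x : X) :
    (M.σ (h + 1) (x, 0) = 0 ∨ M.σ (h + 1) (x, 1) = 0) ↔
      M.σ (h + 1) (x, activeCopy M (h + 1) x + 1) = 0 := by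
  have hp := (H.activeVal_pos h x).ne'
  rw [activeVal] at hp
  generalize activeCopy M (h + 1) x = j at *
  fin_cases j <;> simp_all

/-- Before a delay, the copy that will be active after it holds the value of the clock. -/
lemma invBefore_clk (H : IsSwitching M) (h : ℕ) (x : X) :
    (invBefore M h).clk x = M.σ h (x, activeCopy M (h + 1) x) := by
  rcases h with _ | h
  · rw [invBefore_clk_of_reset M 0 (.inl (H.zero x)), H.active_one, H.zero]
  · by_cases hr : M.σ (h + 1) (x, activeCopy M (h + 1) x + 1) = 0
    · rw [invBefore_clk_of_reset M _ ((H.reset_iff h x).2 hr), H.switch h x hr, hr]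
    · rw [invBefore_clk_of_not_reset M _ (mt (H.reset_iff h x).1 hr), H.keep h x hr, activeVal]

lemma activeVal_zero (H : IsSwitching M) : activeVal M 0 = (invBefore M 0).clk := by
  funext x
  rw [H.invBefore_clk, H.active_one, activeVal, H.active_zero]

lemma invBefore_clk_eq_zero_iff (H : IsSwitching M) (h : ℕ) (x : X) :
    (invBefore M (h + 1)).clk x = 0 ↔ M.σ (h + 1) (x, 0) = 0 ∨ M.σ (h + 1) (x, 1) = 0 := by
  refine ⟨fun e => ?_, invBefore_clk_of_reset M _⟩
  by_contra hr
  rw [invBefore_clk_of_not_reset M _ hr] at e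
  exact (H.activeVal_pos h x).ne' e

lemma activeVal_succ (H : IsSwitching M) {δ : ℕ → ℝ≥0} (hδ : CLTLoc.IsClockAssignment M.σ δ)
    (h : ℕ) (x : X) : activeVal M (h + 1) x = (invBefore M h).clk x + δ h := by
  rw [H.invBefore_clk]
  exact (hδ.2.1 h _).resolve_right (H.activeVal_pos h x).ne'

end IsSwitching

/-! ### The step formulae -/

lemma choice_eq_none_iff (k : Fin K) : choice M h k = none ↔ invSymbols M h k = none := by
  simp [invSymbols, choice]

open Classical in
lemma invSymbols_of_choice {k : Fin K} {t : N.Tr k} (ht : choice M h k = some t) :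
    invSymbols M h k = some ((N.tr k t).action,
      if .edge k ∈ M.π (h + 1) then Edge.ie else Edge.ei) := by
  rw [choice] at ht
  simp [invSymbols, ht]

/-- The step formula at a position: the conjunction `φ₄ ∧ … ∧ φ₈`. -/
noncomputable def stepFormula [Fintype X] [Fintype V] (N : Network AP Act X V K) :
    EncFormula AP X V K :=
  .and (phi4 N) (.and (phi5 N) (.and (phi6 N) (.and (phi7 N) (phi8 N))))

lemma sat_phi4 : M.Sat h (phi4 N) ↔ ∀ k, choice M h k = none →
    (N.inv k ((invBefore M h).loc k)).Sat (invMid M h).clk ∧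
    (N.inv k ((invBefore M h).loc k)).Sat (invBefore M (h + 1)).clk := by
  simp [phi4, -sat_enc, sat_enc_and_r1]

lemma sat_phiEdge (k : Fin K) (a b : N.Loc k) :
    M.Sat (h + 1) (phiEdge N k a b) ↔
      (.edge k ∈ M.π (h + 1) → (N.inv k a).Sat (invMid M h).clk ∧
        (N.inv k b).WeakSat (invBefore M (h + 1)).clk) ∧
      (.edge k ∉ M.π (h + 1) → (N.inv k a).WeakSat (invMid M h).clk ∧
        (N.inv k b).Sat (invBefore M (h + 1)).clk) := by
  by_cases he : .edge k ∈ M.π (h + 1) <;> simp [phiEdge, he]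

lemma sat_phi5 (H : IsSwitching M) : M.Sat h (phi5 N) ↔ ∀ k t, choice M h k = some t →
    (N.tr k t).src = (invBefore M h).loc k ∧ (N.tr k t).varGuard.Sat (invBefore M h).var ∧
    (∀ a ∈ (N.tr k t).assigns,
      (invBefore M (h + 1)).var a.1 = a.2.eval (invBefore M h).var) ∧
    (N.tr k t).dst = (invBefore M (h + 1)).loc k ∧ (N.tr k t).guard.Sat (invMid M h).clk ∧
    (∀ x ∈ (N.tr k t).resets, (invBefore M (h + 1)).clk x = 0) ∧
    M.Sat (h + 1) (phiEdge N k (N.tr k t).src (N.tr k t).dst) := by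
  simp [phi5, encResets, H.invBefore_clk_eq_zero_iff, eq_comm]

lemma sat_phi6 : M.Sat h (phi6 N) ↔
    ∀ k, (invBefore M (h + 1)).loc k ≠ (invBefore M h).loc k →
      ∃ t, choice M h k = some t ∧ (N.tr k t).src = (invBefore M h).loc k ∧
        (N.tr k t).dst = (invBefore M (h + 1)).loc k := by
  simp only [phi6, Interp.sat_all, Interp.sat_imp, Interp.sat_and, Interp.sat_next, sat_locIs,
    Interp.sat_any, sat_transIs, Finset.mem_univ, Finset.mem_filter, true_and, forall_const]
  constructor
  · intro H k hk
    obtain ⟨t, ⟨h1, h2⟩, h3⟩ := H k _ _ hk.symm ⟨rfl, rfl⟩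
    exact ⟨t, h3, h1, h2⟩
  · rintro H k q q' hq ⟨rfl, rfl⟩
    obtain ⟨t, h3, h1, h2⟩ := H k hq.symm
    exact ⟨t, ⟨h1, h2⟩, h3⟩

lemma sat_phi7 [Fintype X] (H : IsSwitching M) : M.Sat h (phi7 N) ↔
    ∀ x, (invBefore M (h + 1)).clk x = 0 →
      ∃ k t, choice M h k = some t ∧ x ∈ (N.tr k t).resets := by
  simp [phi7, H.invBefore_clk_eq_zero_iff, and_comm]

lemma sat_phi8 [Fintype V] : M.Sat h (phi8 N) ↔
    ∀ n, (invBefore M (h + 1)).var n ≠ (invBefore M h).var n →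
      ∃ k t, choice M h k = some t ∧ (N.tr k t).Updates n := by
  simp [phi8, and_comm]

/-- The formulae `φ₄`, …, `φ₈` express that the decoded choice of transitions fires in the decoded
step and that the invariants required by the step hold. -/
lemma sat_stepFormula [Fintype X] [Fintype V] (H : IsSwitching M) :
    M.Sat h (stepFormula N) ↔
      Fires (choice M h) (invSymbols M h) (invMid M h) (invBefore M (h + 1)) ∧
      StepInv (invSymbols M h) (invMid M h) (invBefore M (h + 1)) := by
  simp only [stepFormula, Interp.sat_and]
  rw [sat_phi4, sat_phi5 h H, sat_phi6, sat_phi7 h H, sat_phi8]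
  constructor
  · rintro ⟨h4, h5, h6, h7, h8⟩
    have hloc : ∀ k, choice M h k = none →
        (invBefore M (h + 1)).loc k = (invBefore M h).loc k := by
      intro k hk
      by_contra hne
      obtain ⟨t, ht, -⟩ := h6 k hne
      simp [hk] at ht
    refine ⟨⟨fun k hk => ?_, fun k α b hk => ?_, fun x hx => ?_, fun n hn => ?_⟩, fun k => ?_⟩
    · have hk := (choice_eq_none_iff h k).2 hk
      exact ⟨hk, hloc k hk⟩
    · cases hc : choice M h k with
      | none => simp [(choice_eq_none_iff h k).1 hc] at hk
      | some t =>
        obtain ⟨h1, h2, h3, h4, h5, h6, -⟩ := h5 k t hc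
        rw [invSymbols_of_choice h hc] at hk
        simp only [Option.some.injEq, Prod.mk.injEq] at hk
        exact ⟨t, rfl, h1, h4, hk.1, h5, h2, h6, h3⟩
    · have hne : (invBefore M (h + 1)).clk x ≠ 0 := by
        intro e
        obtain ⟨k, t, hc, ht⟩ := h7 x e
        exact hx k t hc ht
      exact invBefore_clk_of_not_reset M _ (mt (H.invBefore_clk_eq_zero_iff h x).2 hne)
    · by_contra hne
      obtain ⟨k, t, hc, ht⟩ := h8 n hne
      exact hn k t hc ht
    · cases hc : choice M h k with
      | none =>
        rw [(choice_eq_none_iff h k).1 hc]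
        simp only [hloc k hc]
        exact h4 k hc
      | some t =>
        obtain ⟨h1, -, -, h4, -, -, he⟩ := h5 k t hc
        rw [sat_phiEdge, h1, h4] at he
        rw [invSymbols_of_choice h hc, invMid_loc]
        by_cases hp : .edge k ∈ M.π (h + 1)
        · simpa [hp] using he.1 hp
        · simpa [hp] using he.2 hp
  · rintro ⟨⟨hnone, hsome, hclk, hvar⟩, hinv⟩
    refine ⟨fun k hk => ?_, fun k t hc => ?_, fun k hne => ?_, fun x hx => ?_, fun n hn => ?_⟩
    · have hs := (choice_eq_none_iff h k).1 hk
      have hi := hinv k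
      simpa only [hs, (hnone k hs).2, invMid_loc] using hi
    · have hs := invSymbols_of_choice h hc
      obtain ⟨t', ht', h1, h2, -, h3, h4, h5, h6⟩ := hsome k _ _ hs
      obtain rfl : t = t' := Option.some.inj (hc.symm.trans ht')
      refine ⟨h1, h4, h6, h2, h3, h5, ?_⟩
      rw [sat_phiEdge, h1, h2]
      have hi := hinv k
      rw [hs] at hi
      by_cases hp : .edge k ∈ M.π (h + 1)
      · simpa [hp] using hi
      · simpa [hp] using hi
    · cases hs : invSymbols M h k with
      | none => exact absurd (hnone k hs).2 hne
      | some p =>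
        obtain ⟨t, ht, h1, h2, -⟩ := hsome k p.1 p.2 hs
        exact ⟨t, ht, h1, h2⟩
    · by_contra hno
      push Not at hno
      exact (H.activeVal_pos h x).ne' ((hclk x hno).symm.trans hx)
    · by_contra hno
      push Not at hno
      exact hn (hvar n hno)

/-- The models of `φ_N` are the interpretations whose clocks switch correctly and whose decoding
starts in an initial configuration and takes a discrete step after every delay. -/
lemma isModel_phiN_iff [Fintype X] [Fintype V] :
    M.IsModel (phiN N) ↔ IsSwitching M ∧
      (∀ k, (invBefore M 0).loc k = 0) ∧ (∀ n, (invBefore M 0).var n = N.init n) ∧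
      (∀ k, (N.inv k ((invBefore M 0).loc k)).Sat (invBefore M 0).clk) ∧
      ∀ h, Fires (choice M h) (invSymbols M h) (invMid M h) (invBefore M (h + 1)) ∧
        StepInv (invSymbols M h) (invMid M h) (invBefore M (h + 1)) := by
  change M.Sat 0 clockFormula ∧ M.Sat 0 (phi1 N) ∧ M.Sat 0 (phi2 N) ∧ M.Sat 0 (phi3 N) ∧
    M.Sat 0 (globally (stepFormula N)) ↔ _
  rw [sat_clockFormula_iff, and_congr_right_iff]
  intro H
  have h2 : M.Sat 0 (phi2 N) ↔ ∀ n, (invBefore M 0).var n = N.init n := by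
    simp [phi2, invBefore]
  have h3 : M.Sat 0 (phi3 N) ↔
      ∀ k, (N.inv k ((invBefore M 0).loc k)).Sat (invBefore M 0).clk := by
    simp [phi3, H.activeVal_zero]
  rw [h2, h3]
  simp [phi1, sat_stepFormula _ H]

end TANet.Encoding

/-! ### Steps of a network -/

namespace TANet.Network

variable {AP Act X V : Type*} {K : ℕ} {N : Network AP Act X V K} {c c' : N.Config}

/-- The invariants of the sources of a step hold before it, at least weakly. -/
lemma StepInv.source {Λ : N.Symbols} (hΛ : StepInv Λ c c') (k : Fin K) :
    (N.inv k (c.loc k)).Sat c.clk ∨ (N.inv k (c.loc k)).WeakSat c.clk := by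
  have := hΛ k
  split at this
  exacts [.inl this.1, .inr this.1, .inl this.1]

/-- The invariants of the targets of a step hold after it, at least weakly. -/
lemma StepInv.target {Λ : N.Symbols} (hΛ : StepInv Λ c c') (k : Fin K) :
    (N.inv k (c'.loc k)).Sat c'.clk ∨ (N.inv k (c'.loc k)).WeakSat c'.clk := by
  have := hΛ k
  split at this
  exacts [.inl this.2, .inl this.2, .inr this.2]

/-- A step keeps the value of a clock or resets the clock. -/
lemma Fires.clk_eq_or {τ : N.Choice} {Λ : N.Symbols} (hf : Fires τ Λ c c') (x : X) :
    c'.clk x = c.clk x ∨ c'.clk x = 0 := by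
  obtain ⟨hnone, hsome, hclk, -⟩ := hf
  by_cases hx : ∀ k t, τ k = some t → x ∉ (N.tr k t).resets
  · exact .inl (hclk x hx)
  · push Not at hx
    obtain ⟨k, t, ht, hx⟩ := hx
    cases hΛ : Λ k with
    | none => simp [(hnone k hΛ).1] at ht
    | some p =>
      obtain ⟨t', ht', -, -, -, -, -, hr, -⟩ := hsome k p.1 p.2 hΛ
      obtain rfl : t = t' := Option.some.inj (ht.symm.trans ht')
      exact .inr (hr x hx)

/-- A discrete step that is allowed after a delay provides the weak invariant that the delay needs:
an invariant that holds both before and after a delay contains no literal `x = d`. -/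
lemma timeStep_of_inv {δ : ℝ≥0} (hδ : 0 < δ) (hloc : c'.loc = c.loc) (hvar : c'.var = c.var)
    (hclk : ∀ x, c'.clk x = c.clk x + δ)
    (hc : ∀ k, (N.inv k (c.loc k)).Sat c.clk ∨ (N.inv k (c.loc k)).WeakSat c.clk)
    (hc' : ∀ k, (N.inv k (c'.loc k)).Sat c'.clk ∨ (N.inv k (c'.loc k)).WeakSat c'.clk) :
    TimeStep δ c c' := by
  refine ⟨hδ, hloc, hvar, hclk, fun k => ?_⟩
  have hk := hc' k
  rw [hloc] at hk
  exact ClockConstraint.weakSat_of_ne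
    (fun x => by rw [hclk]; exact (lt_add_of_pos_right _ hδ).ne') hk (hc k)

end TANet.Network

/-! ### From interpretations to traces -/

namespace TANet.Encoding

open TANet.Network

lemma isTrace_rhoInv {AP Act X V : Type*} [Fintype X] [Fintype V] {K : ℕ}
    {N : Network AP Act X V K} {M : EncInterp N} (hM : M.IsModel (phiN N)) :
    IsTrace (rhoInv M) := by
  obtain ⟨H, hloc, hvar, hinv, hstep⟩ := isModel_phiN_iff.1 hM
  have hδ : CLTLoc.IsClockAssignment M.σ M.delay := M.clockAssignment.choose_spec
  have hbefore : ∀ h k, (N.inv k ((invBefore M h).loc k)).Sat (invBefore M h).clk ∨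
      (N.inv k ((invBefore M h).loc k)).WeakSat (invBefore M h).clk := by
    rintro (_ | h) k
    exacts [.inl (hinv k), (hstep h).2.target k]
  have htime : ∀ h, TimeStep (M.delay h) (invBefore M h) (invMid M h) := fun h =>
    timeStep_of_inv (hδ.1 h) rfl rfl (H.activeVal_succ hδ h) (hbefore h) (hstep h).2.source
  have hparity : ∀ i, i = 2 * (i / 2) ∨ i = 2 * (i / 2) + 1 := fun i => by omega
  have conf_even : ∀ h, (rhoInv M).conf (2 * h) = invBefore M h := fun h => by
    simp [rhoInv]
  have conf_odd : ∀ h, (rhoInv M).conf (2 * h + 1) = invMid M h := fun h => by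
    simp [rhoInv, show (2 * h + 1) / 2 = h by omega, Nat.add_mod]
  have ev_even : ∀ h, (rhoInv M).ev (2 * h) = .delay (M.delay h) := fun h => by
    simp [rhoInv]
  have ev_odd : ∀ h, (rhoInv M).ev (2 * h + 1) = .disc (invSymbols M h) := fun h => by
    simp [rhoInv, show (2 * h + 1) / 2 = h by omega, Nat.add_mod]
  have conf_zero : (rhoInv M).conf 0 = invBefore M 0 := conf_even 0
  refine ⟨fun i n => ?_, fun i => ?_, ?_, ?_, ?_, ?_, ?_, fun i hi => ?_⟩
  · rcases hparity i with hi | hi <;> rw [hi]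
    · rw [conf_even]
      exact M.mem_dom _ (.var n)
    · rw [conf_odd]
      exact M.mem_dom _ (.var n)
  · rcases hparity i with hi | hi <;> rw [hi]
    · rw [ev_even, conf_even, conf_odd]
      exact htime _
    · rw [ev_odd, conf_odd, show 2 * (i / 2) + 1 + 1 = 2 * (i / 2 + 1) by ring, conf_even]
      exact ⟨⟨_, (hstep _).1⟩, (hstep _).2⟩
  · rw [show (rhoInv M).ev 0 = _ from ev_even 0]
    exact id
  · rwa [conf_zero]
  · rwa [conf_zero]
  · intro x
    rw [conf_zero, invBefore_clk_of_reset M 0 (.inl (H.zero x))]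
  · rwa [conf_zero]
  · rcases hparity i with h | h <;> rw [h] at hi ⊢
    · rw [ev_even] at hi
      exact hi.elim
    · rw [show 2 * (i / 2) + 1 + 1 = 2 * (i / 2 + 1) by ring, ev_even]
      exact id

end TANet.Encoding

/-! ### From traces to interpretations -/

namespace TANet.Network.IsTrace

variable {AP Act X V : Type*} {K : ℕ} {N : Network AP Act X V K} {η : N.Run}

lemma not_isDisc_pos (hη : IsTrace η) (h : ℕ) : ¬ (η.ev (η.pos h)).IsDisc := by
  induction h with
  | zero => exact hη.first
  | succ h ih =>
    rw [Run.pos]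
    split_ifs with hd
    exacts [hη.alternate _ hd, hd]

lemma timeStep (hη : IsTrace η) (h : ℕ) : TimeStep (η.dur h) (η.before h) (η.mid h) := by
  have hs := hη.step (η.pos h)
  have hd := hη.not_isDisc_pos h
  rw [Run.dur]
  cases he : η.ev (η.pos h) with
  | delay δ => rwa [he] at hs
  | disc Λ => exact absurd (by rw [he]; trivial) hd

/-- After a delay, either a discrete step of the trace follows, or an idle step was inserted. -/
lemma stepInv_or_eq (hη : IsTrace η) (h : ℕ) :
    StepInv (η.symbols h) (η.mid h) (η.before (h + 1)) ∨
      (∀ k, η.symbols h k = none) ∧ η.before (h + 1) = η.mid h := by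
  have hs := hη.step (η.pos h + 1)
  simp only [Run.symbols, Run.before, Run.mid]
  cases he : η.ev (η.pos h + 1) with
  | delay δ =>
    have hpos : η.pos (h + 1) = η.pos h + 1 := if_neg (by rw [he]; exact id)
    exact .inr ⟨fun k => rfl, by rw [hpos]⟩
  | disc Λ =>
    have hpos : η.pos (h + 1) = η.pos h + 2 := if_pos (by rw [he]; trivial)
    rw [he] at hs
    rw [hpos]
    exact .inl hs.2

lemma inv_before (hη : IsTrace η) (h : ℕ) (k : Fin K) :
    (N.inv k ((η.before h).loc k)).Sat (η.before h).clk ∨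
      (N.inv k ((η.before h).loc k)).WeakSat (η.before h).clk := by
  rcases h with _ | h
  · exact .inl (hη.init_inv k)
  · rcases hη.stepInv_or_eq h with hs | ⟨-, he⟩
    · exact hs.target k
    · obtain ⟨-, hloc, -, -, hw⟩ := hη.timeStep h
      rw [he, hloc]
      exact .inr (hw k)

/-- The idle steps inserted between two delays respect the invariants strongly. A delay ensures the
invariant of its target only weakly, but the invariant also holds weakly after the following delay,
and it is convex. -/
lemma stepInv (hη : IsTrace η) (h : ℕ) :
    StepInv (η.symbols h) (η.mid h) (η.before (h + 1)) := by
  rcases hη.stepInv_or_eq h with hs | ⟨hnone, he⟩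
  · exact hs
  · obtain ⟨hδ, hloc, -, hclk, hw⟩ := hη.timeStep h
    obtain ⟨hδ', -, -, hclk', hw'⟩ := hη.timeStep (h + 1)
    rw [he] at hclk' hw'
    intro k
    have hb := hη.inv_before h k
    have hk := hw k
    have hk' := hw' k
    rw [← hloc] at hb hk
    have hweak := ClockConstraint.weakSat_of_ne
      (fun x => by rw [hclk]; exact (lt_add_of_pos_right _ hδ).ne) hb (.inr hk)
    have := ClockConstraint.sat_of_weakSat_of_convex ((N.aut k).inv_convex _) hδ hδ' hclk hclk'
      hweak hk'
    rw [hnone k, he]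
    exact ⟨this, this⟩

end TANet.Network.IsTrace

namespace TANet.Encoding.InRho

open TANet.Network

variable {AP Act X V : Type*} {K : ℕ} {N : Network AP Act X V K} {η : N.Run} {M : EncInterp N}

lemma activeVal_succ (hM : InRho η M) (h : ℕ) (x : X) :
    activeVal M (h + 1) x = M.σ h (x, activeCopy M (h + 1) x) + η.dur h :=
  hM.clk_active h x

lemma inactive_eq_zero_iff (hM : InRho η M) (hη : IsTrace η) (h : ℕ) (x : X) :
    M.σ (h + 1) (x, activeCopy M (h + 1) x + 1) = 0 ↔ (η.before (h + 1)).clk x = 0 := by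
  refine ⟨fun e => ?_, (hM.clk_inactive h x).1⟩
  by_contra hne
  rw [(hM.clk_inactive h x).2 hne] at e
  exact (hη.timeStep h).1.ne' (add_eq_zero.1 e).2

lemma isSwitching (hM : InRho η M) (hη : IsTrace η) : IsSwitching M where
  zero x := (hM.clk_zero x).1
  pos x := (hM.clk_zero x).2
  active_zero x := by simp [activeCopy, (hM.act_zero x).1]
  active_one x := by simp [activeCopy, (hM.act_zero x).2]
  activeVal_pos h x := by
    rw [hM.activeVal_succ]
    exact add_pos_of_nonneg_of_pos zero_le (hη.timeStep h).1
  switch h x hr := by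
    have hs := (hM.act_succ h x).1 ((hM.inactive_eq_zero_iff hη h x).1 hr)
    have hd : M.ι (h + 1) (.active x) = 0 ∨ M.ι (h + 1) (.active x) = 1 :=
      M.mem_dom _ (.active x)
    rcases hd with hd | hd <;> simp [activeCopy, hs, hd]
  keep h x hr := by
    have hs := (hM.act_succ h x).2 (mt (hM.inactive_eq_zero_iff hη h x).2 hr)
    simp [activeCopy, hs]

lemma invBefore_clk (hM : InRho η M) (hη : IsTrace η) (h : ℕ) :
    (invBefore M h).clk = (η.before h).clk := by
  have H := hM.isSwitching hη
  funext x
  induction h with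
  | zero =>
    rw [invBefore_clk_of_reset M 0 (.inl (H.zero x))]
    exact (hη.init_clk x).symm
  | succ h ih =>
    by_cases hz : (η.before (h + 1)).clk x = 0
    · rw [hz, H.invBefore_clk_eq_zero_iff, H.reset_iff, hM.inactive_eq_zero_iff hη, hz]
    · obtain ⟨τ, hτ, -⟩ := hM.trans h
      have hr := hz
      rw [← hM.inactive_eq_zero_iff hη, ← H.reset_iff] at hr
      rw [invBefore_clk_of_not_reset M _ hr, hM.activeVal_succ, ← H.invBefore_clk, ih,
        (hτ.clk_eq_or x).resolve_right hz, (hη.timeStep h).2.2.2.1]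

/-- Decoding an interpretation in `ρ(η)` gives back the configurations of `η`. -/
lemma invBefore_eq (hM : InRho η M) (hη : IsTrace η) (h : ℕ) :
    invBefore M h = η.before h := by
  have hclk := hM.invBefore_clk hη h
  have hloc : (invBefore M h).loc = (η.before h).loc := by
    funext k
    simp only [invBefore, hM.loc, decodeLoc_val]
  have hvar : (invBefore M h).var = (η.before h).var := funext (hM.var h)
  calc invBefore M h = ⟨(invBefore M h).loc, (invBefore M h).var, (invBefore M h).clk⟩ := rfl
    _ = η.before h := by rw [hclk, hloc, hvar]

lemma invMid_eq (hM : InRho η M) (hη : IsTrace η) (h : ℕ) : invMid M h = η.mid h := by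
  obtain ⟨-, hloc, hvar, hclk, -⟩ := hη.timeStep h
  have hclk' : (invMid M h).clk = (η.mid h).clk := by
    funext x
    rw [invMid_clk, hM.activeVal_succ, ← (hM.isSwitching hη).invBefore_clk, hclk,
      hM.invBefore_eq hη]
  have hloc' : (invMid M h).loc = (η.mid h).loc := by
    rw [invMid_loc, hM.invBefore_eq hη, hloc]
  have hvar' : (invMid M h).var = (η.mid h).var := by
    rw [invMid_var, hM.invBefore_eq hη, hvar]
  calc invMid M h = ⟨(invMid M h).loc, (invMid M h).var, (invMid M h).clk⟩ := rfl
    _ = η.mid h := by rw [hclk', hloc', hvar']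

lemma fires_choice (hM : InRho η M) (h : ℕ) :
    Fires (choice M h) (η.symbols h) (η.mid h) (η.before (h + 1)) := by
  obtain ⟨τ, hτ, hc⟩ := hM.trans h
  have : choice M h = τ := by
    funext k
    rw [choice, hc, decodeTrans_code]
  rwa [this]

lemma invSymbols_eq (hM : InRho η M) (h : ℕ) : invSymbols M h = η.symbols h := by
  obtain ⟨hnone, hsome, -⟩ := hM.fires_choice h
  funext k
  cases hs : η.symbols h k with
  | none => exact (choice_eq_none_iff h k).1 (hnone k hs).1
  | some p =>
    obtain ⟨α, b⟩ := p
    obtain ⟨t, ht, -, -, rfl, -⟩ := hsome k α b hs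
    rw [invSymbols_of_choice h ht]
    have he := hM.edge h k _ b hs
    cases b <;> simp [he]

lemma isModel [Fintype X] [Fintype V] (hM : InRho η M) (hη : IsTrace η) :
    M.IsModel (phiN N) := by
  refine isModel_phiN_iff.2 ⟨hM.isSwitching hη, ?_⟩
  simp only [hM.invBefore_eq hη, hM.invMid_eq hη, hM.invSymbols_eq]
  exact ⟨hη.init_loc, hη.init_var, hη.init_inv, fun h => ⟨hM.fires_choice h, hη.stepInv h⟩⟩

end TANet.Encoding.InRho

theorem mainTheorem2 {AP Act X V : Type*} [Fintype X] [Nonempty X] [Fintype V] {K : ℕ}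
    (N : TANet.Network AP Act X V K) :
    (∀ η : N.Run, TANet.Network.IsTrace η →
      ∀ M ∈ TANet.Encoding.rho η, M.IsModel (TANet.Encoding.phiN N)) ∧
    (∀ M : TANet.Encoding.EncInterp N, M.IsModel (TANet.Encoding.phiN N) →
      TANet.Network.IsTrace (TANet.Encoding.rhoInv M)) := by
  exact ⟨fun _ hη _ hM => hM.isModel hη, fun _ hM => TANet.Encoding.isTrace_rhoInv hM⟩
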